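/- Let $\mathcal A$ be a complex Banach algebra (not assumed unital or commutative) and let $\varphi$ be a character on $\mathcal A$, i.e. a non-zero multiplicative bounded linear functional. For $f\in\mathcal A^*$ and $a\in\mathcal A$ define $f\cdot a,\ a\cdot f\in\mathcal A^*$ by $\langle f\cdot a,b\rangle=\langle f,ab\rangle$ and $\langle a\cdot f,b\rangle=\langle f,ba\rangle$. A topologically two-sided invariant $\varphi$-mean on $\mathcal A^*$ is an $m\in\mathcal A^{**}$ with $m(\varphi)=1$ and $\langle m,f\cdot a\rangle=\varphi(a)\langle m,f\rangle=\langle m,a\cdot f\rangle$ for all $f\in\mathcal A^*$, $a\in\mathcal A$. Suppose that: - $\mathcal A$ is separable and weakly sequentially complete (every weakly Cauchy sequence is weakly convergent); - $\mathcal A$ is faithful: for each $a\neq 0$ there are $b,c\in\mathcal A$ with $ab\neq 0$ and $ca\neq 0$; - the closed linear span of $\{ab : a\in\mathcal A,\ b\in I_\varphi\}$ equals $I_\varphi:=\{a\in\mathcal A:\varphi(a)=0\}$; - $\mathcal A$ is two-sided $\varphi$-amenable, i.e. there is a topologically two-sided invariant $\varphi$-mean on $\mathcal A^*$. Let $\mathcal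 A_M$ be the Banach algebra obtained by completing $\mathcal A$ in the multiplier norm $\|a\|_M=\sup_{\|b\|\le 1}\{\|ab\|,\|ba\|\}$. If $\mathcal A_M$ is Arens regular, i.e. the left and right Arens products on $\mathcal A_M^{**}$ coincide, then there is a unique topologically two-sided invariant $\varphi$-mean on $\mathcal A^*$, and it lies in $\mathcal A$: there is exactly one $m\in\mathcal A^{**}$ that is a topologically two-sided invariant $\varphi$-mean on $\mathcal A^*$, and exactly one $u\in\mathcal A$ whose canonical image in $\mathcal A^{**}$ is such a mean. -/

import Mathlib

open Filter Topology

noncomputable section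

namespace BanachMean

variable (A : Type*) [NonUnitalNormedRing A]

/-- `A` is faithful: for every `a ≠ 0` there are `b, c` with `a b ≠ 0` and `c a ≠ 0`. -/
def IsFaithful : Prop :=
  ∀ a : A, a ≠ 0 → (∃ b : A, a * b ≠ 0) ∧ ∃ c : A, c * a ≠ 0

variable [NormedSpace ℂ A]

/-- Every weakly Cauchy sequence converges weakly. -/
def IsWeaklySequentiallyComplete : Prop :=
  ∀ x : ℕ → A, (∀ f : StrongDual ℂ A, CauchySeq fun n => f (x n)) →
    ∃ y : A, ∀ f : StrongDual ℂ A, Tendsto (fun n => f (x n)) atTop (𝓝 (f y))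

variable [IsScalarTower ℂ A A] [SMulCommClass ℂ A A]

/-! ### Module actions on the dual, and the two Arens products -/

section Arens

/-- `dualMul f a` is the functional `f · a`, where `⟨f · a, b⟩ = ⟨f, a b⟩`. -/
def dualMul : StrongDual ℂ A →L[ℂ] A →L[ℂ] StrongDual ℂ A :=
  ((ContinuousLinearMap.compL ℂ A (A →L[ℂ] A) (StrongDual ℂ A)).flip
    (ContinuousLinearMap.mul ℂ A)).comp (ContinuousLinearMap.compL ℂ A A ℂ)

/-- `mulDual f a` is the functional `a · f`, where `⟨a · f, b⟩ = ⟨f, b a⟩`. -/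
def mulDual : StrongDual ℂ A →L[ℂ] A →L[ℂ] StrongDual ℂ A :=
  ((ContinuousLinearMap.compL ℂ A (A →L[ℂ] A) (StrongDual ℂ A)).flip
    (ContinuousLinearMap.mul ℂ A).flip).comp (ContinuousLinearMap.compL ℂ A A ℂ)

variable {A}

@[simp] theorem dualMul_apply (f : StrongDual ℂ A) (a b : A) :
    dualMul A f a b = f (a * b) := rfl

@[simp] theorem mulDual_apply (f : StrongDual ℂ A) (a b : A) :
    mulDual A f a b = f (b * a) := rfl

/-- The map `f ↦ n · f` on the dual, where `⟨n · f, a⟩ = ⟨n, f · a⟩`. -/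
def bidualMul (n : StrongDual ℂ (StrongDual ℂ A)) : StrongDual ℂ A →L[ℂ] StrongDual ℂ A :=
  (ContinuousLinearMap.compL ℂ A (StrongDual ℂ A) ℂ n).comp (dualMul A)

/-- The map `f ↦ f · n` on the dual, where `⟨f · n, a⟩ = ⟨n, a · f⟩`. -/
def mulBidual (n : StrongDual ℂ (StrongDual ℂ A)) : StrongDual ℂ A →L[ℂ] StrongDual ℂ A :=
  (ContinuousLinearMap.compL ℂ A (StrongDual ℂ A) ℂ n).comp (mulDual A)

@[simp] theorem bidualMul_apply (n : StrongDual ℂ (StrongDual ℂ A)) (f : StrongDual ℂ A) (a : A) :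
    bidualMul n f a = n (dualMul A f a) := rfl

@[simp] theorem mulBidual_apply (n : StrongDual ℂ (StrongDual ℂ A)) (f : StrongDual ℂ A) (a : A) :
    mulBidual n f a = n (mulDual A f a) := rfl

/-- The left Arens product: `⟨m □ n, f⟩ = ⟨m, n · f⟩`. -/
def leftArens (m n : StrongDual ℂ (StrongDual ℂ A)) : StrongDual ℂ (StrongDual ℂ A) :=
  m.comp (bidualMul n)

/-- The right Arens product: `⟨m ◇ n, f⟩ = ⟨n, f · m⟩`. -/
def rightArens (m n : StrongDual ℂ (StrongDual ℂ A)) : StrongDual ℂ (StrongDual ℂ A) :=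
  n.comp (mulBidual m)

variable (A)

/-- Arens regularity: the two Arens products on the second dual coincide. -/
def IsArensRegular : Prop :=
  ∀ m n : StrongDual ℂ (StrongDual ℂ A), leftArens m n = rightArens m n

end Arens

/-! ### Means attached to a character -/

section Means

variable {A}

/-- A character `φ`, as an element of the dual Banach space. -/
def charDual (φ : WeakDual.characterSpace ℂ A) : StrongDual ℂ A :=
  WeakDual.toStrongDual (φ : WeakDual ℂ A)

/-- Topologically two-sided invariant `φ`-means on `A*`. -/
structure IsTwoSidedMean (φ : WeakDual.characterSpace ℂ A)
    (m : StrongDual ℂ (StrongDual ℂ A)) : Prop where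
  map_char : m (charDual φ) = 1
  left_inv : ∀ (f : StrongDual ℂ A) (a : A), m (dualMul A f a) = φ a * m f
  right_inv : ∀ (f : StrongDual ℂ A) (a : A), m (mulDual A f a) = φ a * m f

/-- `A` is two-sided `φ`-amenable. -/
def IsTwoSidedAmenable (φ : WeakDual.characterSpace ℂ A) : Prop :=
  ∃ m : StrongDual ℂ (StrongDual ℂ A), IsTwoSidedMean φ m

/-- The augmentation ideal `I_φ = {a | φ a = 0}`, as a subspace. -/
def augIdeal (φ : WeakDual.characterSpace ℂ A) : Submodule ℂ A :=
  LinearMap.ker (charDual φ).toLinearMap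

/-- The closed linear span of the set of products `a b` with `a ∈ A` and `b ∈ I_φ`. -/
def closedSpanMulAugIdeal (φ : WeakDual.characterSpace ℂ A) : Submodule ℂ A :=
  (Submodule.span ℂ {x : A | ∃ a b : A, b ∈ augIdeal φ ∧ x = a * b}).topologicalClosure

end Means

/-! ### The multiplier norm and the completion `A_M` -/

section Multiplier

variable {A}

/-- The multiplier seminorm `sup {‖a b‖, ‖b a‖ : ‖b‖ ≤ 1}`. -/
def multiplierNorm (a : A) : ℝ :=
  sSup {r : ℝ | ∃ b : A, ‖b‖ ≤ 1 ∧ (r = ‖a * b‖ ∨ r = ‖b * a‖)}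

theorem multiplierNorm_eq_max (a : A) :
    multiplierNorm a =
      max ‖ContinuousLinearMap.mul ℂ A a‖ ‖(ContinuousLinearMap.mul ℂ A).flip a‖ := by
  have hb : BddAbove {r : ℝ | ∃ b : A, ‖b‖ ≤ 1 ∧ (r = ‖a * b‖ ∨ r = ‖b * a‖)} := by
    refine ⟨‖a‖, ?_⟩
    rintro r ⟨b, hb, rfl | rfl⟩
    · exact (norm_mul_le _ _).trans (mul_le_of_le_one_right (norm_nonneg _) hb)
    · exact (norm_mul_le _ _).trans (mul_le_of_le_one_left (norm_nonneg _) hb)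
  have h0 : 0 ≤ multiplierNorm a := le_csSup hb ⟨0, by simp, Or.inl (by simp)⟩
  apply le_antisymm
  · refine csSup_le ⟨0, 0, by simp, Or.inl (by simp)⟩ ?_
    rintro r ⟨b, hb, rfl | rfl⟩
    · exact le_max_of_le_left ((ContinuousLinearMap.mul ℂ A a).unit_le_opNorm b hb)
    · exact le_max_of_le_right (((ContinuousLinearMap.mul ℂ A).flip a).unit_le_opNorm b hb)
  · refine max_le ?_ ?_
    · refine ContinuousLinearMap.opNorm_le_of_unit_norm h0 fun b hb1 => ?_
      exact le_csSup hb ⟨b, hb1.le, Or.inl rfl⟩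
    · refine ContinuousLinearMap.opNorm_le_of_unit_norm h0 fun b hb1 => ?_
      exact le_csSup hb ⟨b, hb1.le, Or.inr rfl⟩

theorem norm_mul_le_multiplierNorm (a b : A) : ‖a * b‖ ≤ multiplierNorm a * ‖b‖ := by
  rw [multiplierNorm_eq_max]
  exact ((ContinuousLinearMap.mul ℂ A a).le_opNorm b).trans
    (mul_le_mul_of_nonneg_right (le_max_left _ _) (norm_nonneg _))

theorem norm_mul_le_multiplierNorm' (a b : A) : ‖b * a‖ ≤ multiplierNorm a * ‖b‖ := by
  rw [multiplierNorm_eq_max]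
  exact (((ContinuousLinearMap.mul ℂ A).flip a).le_opNorm b).trans
    (mul_le_mul_of_nonneg_right (le_max_right _ _) (norm_nonneg _))

theorem multiplierNorm_nonneg (a : A) : 0 ≤ multiplierNorm a := by
  rw [multiplierNorm_eq_max]
  exact le_max_of_le_left (norm_nonneg _)

theorem multiplierNorm_le (a : A) {C : ℝ} (hC : 0 ≤ C)
    (h1 : ∀ b, ‖a * b‖ ≤ C * ‖b‖) (h2 : ∀ b, ‖b * a‖ ≤ C * ‖b‖) : multiplierNorm a ≤ C := by
  rw [multiplierNorm_eq_max]
  exact max_le (ContinuousLinearMap.opNorm_le_bound _ hC h1)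
    (ContinuousLinearMap.opNorm_le_bound _ hC h2)

theorem multiplierNorm_mul_le (a b : A) :
    multiplierNorm (a * b) ≤ multiplierNorm a * multiplierNorm b := by
  refine multiplierNorm_le _ (mul_nonneg (multiplierNorm_nonneg a) (multiplierNorm_nonneg b))
    (fun c => ?_) (fun c => ?_)
  · rw [mul_assoc, mul_assoc]
    exact (norm_mul_le_multiplierNorm a _).trans
      (mul_le_mul_of_nonneg_left (norm_mul_le_multiplierNorm b c) (multiplierNorm_nonneg a))
  · rw [← mul_assoc, mul_comm (multiplierNorm a), mul_assoc (multiplierNorm b)]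
    exact (norm_mul_le_multiplierNorm' b _).trans
      (mul_le_mul_of_nonneg_left (norm_mul_le_multiplierNorm' a c) (multiplierNorm_nonneg b))

/-- The multiplier seminorm is a seminorm. -/
def multiplierSeminorm : Seminorm ℂ A :=
  Seminorm.of multiplierNorm
    (fun a b => by
      refine multiplierNorm_le _ (add_nonneg (multiplierNorm_nonneg a) (multiplierNorm_nonneg b))
        (fun c => ?_) (fun c => ?_)
      · rw [add_mul, add_mul]
        exact (norm_add_le _ _).trans
          (add_le_add (norm_mul_le_multiplierNorm a c) (norm_mul_le_multiplierNorm b c))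
      · rw [mul_add, add_mul]
        exact (norm_add_le _ _).trans
          (add_le_add (norm_mul_le_multiplierNorm' a c) (norm_mul_le_multiplierNorm' b c)))
    (fun k a => by
      rw [multiplierNorm_eq_max, multiplierNorm_eq_max, map_smul, map_smul, norm_smul, norm_smul,
        mul_max_of_nonneg _ _ (norm_nonneg k)])

variable (A)

/-- A copy of the algebra `A`, to be normed by the multiplier norm. -/
def WithMultiplierNorm : Type _ := A

instance : NonUnitalRing (WithMultiplierNorm A) := inferInstanceAs (NonUnitalRing A)

instance : Module ℂ (WithMultiplierNorm A) := inferInstanceAs (Module ℂ A)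

instance : IsScalarTower ℂ (WithMultiplierNorm A) (WithMultiplierNorm A) :=
  inferInstanceAs (IsScalarTower ℂ A A)

instance : SMulCommClass ℂ (WithMultiplierNorm A) (WithMultiplierNorm A) :=
  inferInstanceAs (SMulCommClass ℂ A A)

/-- The multiplier norm on the copy of `A`. -/
def WithMultiplierNorm.addGroupSeminorm : AddGroupSeminorm (WithMultiplierNorm A) :=
  (multiplierSeminorm (A := A)).toAddGroupSeminorm

instance : NonUnitalSeminormedRing (WithMultiplierNorm A) :=
  { (inferInstance : NonUnitalRing (WithMultiplierNorm A)),
    (WithMultiplierNorm.addGroupSeminorm A).toSeminormedAddCommGroup with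
    norm_mul_le := multiplierNorm_mul_le (A := A) }

instance : NormedSpace ℂ (WithMultiplierNorm A) where
  norm_smul_le k a := (map_smul_eq_mul (multiplierSeminorm (A := A)) k a).le

/-- `A_M`: the completion of `A` with respect to the multiplier norm. -/
def MultiplierCompletion : Type _ := UniformSpace.Completion (WithMultiplierNorm A)

namespace MultiplierCompletion

instance : NormedAddCommGroup (MultiplierCompletion A) :=
  inferInstanceAs (NormedAddCommGroup (UniformSpace.Completion (WithMultiplierNorm A)))

instance : NormedSpace ℂ (MultiplierCompletion A) :=
  inferInstanceAs (NormedSpace ℂ (UniformSpace.Completion (WithMultiplierNorm A)))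

instance : CompleteSpace (MultiplierCompletion A) :=
  inferInstanceAs (CompleteSpace (UniformSpace.Completion (WithMultiplierNorm A)))

variable {A}

/-- The canonical linear map `i : A → A_M`. -/
def incl : A →ₗ[ℂ] MultiplierCompletion A :=
  (UniformSpace.Completion.toComplL : WithMultiplierNorm A →L[ℂ]
    UniformSpace.Completion (WithMultiplierNorm A)).toLinearMap

theorem norm_incl (a : A) : ‖incl a‖ = multiplierNorm a :=
  UniformSpace.Completion.norm_coe (E := WithMultiplierNorm A) a

theorem denseRange_incl : DenseRange (incl : A → MultiplierCompletion A) :=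
  UniformSpace.Completion.denseRange_coe (α := WithMultiplierNorm A)

/-- The product of `A_M`: the continuous extension of the product of `A`. -/
instance : Mul (MultiplierCompletion A) :=
  ⟨fun x y => (UniformSpace.Completion.isDenseInducing_coe.prodMap
    UniformSpace.Completion.isDenseInducing_coe).extend
      (fun p : WithMultiplierNorm A × WithMultiplierNorm A =>
        ((p.1 * p.2 : WithMultiplierNorm A) :
          UniformSpace.Completion (WithMultiplierNorm A))) (x, y)⟩

theorem incl_mul (a b : A) : incl (a * b) = incl a * incl b :=
  ((UniformSpace.Completion.isDenseInducing_coe.prodMap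
    UniformSpace.Completion.isDenseInducing_coe).extend_eq
      ((UniformSpace.Completion.continuous_coe (WithMultiplierNorm A)).comp
        continuous_mul) (a, b)).symm

theorem continuous_mul' : Continuous fun p : MultiplierCompletion A × MultiplierCompletion A =>
    p.1 * p.2 := by
  let m := (AddMonoidHom.mul : WithMultiplierNorm A →+ WithMultiplierNorm A →+
    WithMultiplierNorm A).compr₂ UniformSpace.Completion.toCompl
  have hm : Continuous fun p : WithMultiplierNorm A × WithMultiplierNorm A => m p.1 p.2 :=
    (UniformSpace.Completion.continuous_coe (WithMultiplierNorm A)).comp continuous_mul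
  have di : IsDenseInducing (UniformSpace.Completion.toCompl : WithMultiplierNorm A →
    UniformSpace.Completion (WithMultiplierNorm A)) :=
      UniformSpace.Completion.isDenseInducing_coe
  exact di.extend_Z_bilin di hm

instance : ContinuousMul (MultiplierCompletion A) := ⟨continuous_mul'⟩

theorem induction₁ {p : MultiplierCompletion A → Prop} (hp : IsClosed {x | p x})
    (h : ∀ a : A, p (incl a)) (x : MultiplierCompletion A) : p x :=
  denseRange_incl.induction_on x hp h

theorem induction₂ {p : MultiplierCompletion A → MultiplierCompletion A → Prop}
    (hp : IsClosed {q : MultiplierCompletion A × MultiplierCompletion A | p q.1 q.2})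
    (h : ∀ a b : A, p (incl a) (incl b)) (x y : MultiplierCompletion A) : p x y :=
  denseRange_incl.induction_on₂ hp h x y

theorem induction₃
    {p : MultiplierCompletion A → MultiplierCompletion A → MultiplierCompletion A → Prop}
    (hp : IsClosed {q : MultiplierCompletion A × MultiplierCompletion A × MultiplierCompletion A |
      p q.1 q.2.1 q.2.2})
    (h : ∀ a b c : A, p (incl a) (incl b) (incl c)) (x y z : MultiplierCompletion A) : p x y z :=
  denseRange_incl.induction_on₃ hp h x y z

theorem zero_mul' (x : MultiplierCompletion A) : 0 * x = 0 := by
  refine induction₁ (p := fun x => 0 * x = 0) (isClosed_eq (by fun_prop) (by fun_prop))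
    (fun a => ?_) x
  rw [← map_zero incl, ← incl_mul, zero_mul]

theorem mul_zero' (x : MultiplierCompletion A) : x * 0 = 0 := by
  refine induction₁ (p := fun x => x * 0 = 0) (isClosed_eq (by fun_prop) (by fun_prop))
    (fun a => ?_) x
  rw [← map_zero incl, ← incl_mul, mul_zero]

theorem mul_assoc' (x y z : MultiplierCompletion A) : x * y * z = x * (y * z) := by
  refine induction₃ (p := fun x y z => x * y * z = x * (y * z))
    (isClosed_eq (by fun_prop) (by fun_prop)) (fun a b c => ?_) x y z
  simp only [← incl_mul, mul_assoc]

theorem mul_add' (x y z : MultiplierCompletion A) : x * (y + z) = x * y + x * z := by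
  refine induction₃ (p := fun x y z => x * (y + z) = x * y + x * z)
    (isClosed_eq (by fun_prop) (by fun_prop)) (fun a b c => ?_) x y z
  rw [← map_add incl b c, ← incl_mul, mul_add, map_add, incl_mul, incl_mul]

theorem add_mul' (x y z : MultiplierCompletion A) : (x + y) * z = x * z + y * z := by
  refine induction₃ (p := fun x y z => (x + y) * z = x * z + y * z)
    (isClosed_eq (by fun_prop) (by fun_prop)) (fun a b c => ?_) x y z
  rw [← map_add incl a b, ← incl_mul, add_mul, map_add, incl_mul, incl_mul]

theorem norm_mul_le' (x y : MultiplierCompletion A) : ‖x * y‖ ≤ ‖x‖ * ‖y‖ := by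
  refine induction₂ (p := fun x y => ‖x * y‖ ≤ ‖x‖ * ‖y‖)
    (isClosed_le (by fun_prop) (by fun_prop)) (fun a b => ?_) x y
  rw [← incl_mul, norm_incl, norm_incl, norm_incl]
  exact multiplierNorm_mul_le a b

theorem smul_mul' (k : ℂ) (x y : MultiplierCompletion A) : (k • x) * y = k • (x * y) := by
  refine induction₂ (p := fun x y => (k • x) * y = k • (x * y))
    (isClosed_eq ((continuous_fst.const_smul k).mul continuous_snd)
      ((continuous_fst.mul continuous_snd).const_smul k)) (fun a b => ?_) x y
  simp only [← incl_mul, ← map_smul, smul_mul_assoc]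

theorem mul_smul' (k : ℂ) (x y : MultiplierCompletion A) : x * (k • y) = k • (x * y) := by
  refine induction₂ (p := fun x y => x * (k • y) = k • (x * y))
    (isClosed_eq (continuous_fst.mul (continuous_snd.const_smul k))
      ((continuous_fst.mul continuous_snd).const_smul k)) (fun a b => ?_) x y
  simp only [← incl_mul, ← map_smul, mul_smul_comm]

instance : NonUnitalNormedRing (MultiplierCompletion A) :=
  { (inferInstance : NormedAddCommGroup (MultiplierCompletion A)) with
    mul := (· * ·)
    zero_mul := zero_mul'
    mul_zero := mul_zero'
    mul_assoc := mul_assoc'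
    left_distrib := mul_add'
    right_distrib := add_mul'
    norm_mul_le := norm_mul_le' }

instance : IsScalarTower ℂ (MultiplierCompletion A) (MultiplierCompletion A) :=
  ⟨fun k x y => smul_mul' k x y⟩

instance : SMulCommClass ℂ (MultiplierCompletion A) (MultiplierCompletion A) :=
  ⟨fun k x y => (mul_smul' k x y).symm⟩

end MultiplierCompletion

end Multiplier

end BanachMean

end

/-! Uniqueness comes from Arens regularity. A functional on `A` need not be bounded for the
multiplier norm, but `f · a` always is, and `φ = φ · a` when `φ a = 1`. So `f · a` and `φ` extend to
functionals `F` and `Φ` on `A_M`. Push two means `m`, `n` to the bidual of `A_M`. Invariance gives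
`n · F = ⟨n, F⟩ Φ` and `F · m = ⟨m, F⟩ Φ`, so the left Arens product of `m` and `n` takes the value
`⟨n, F⟩ = n f` at `F`, and the right one the value `⟨m, F⟩ = m f`. Equality of the products forces
`m = n` (`IsTwoSidedMean.unique`).

That the mean lies in `A` then follows from uniqueness. Hahn–Banach and separability yield a bounded
sequence in `A` that is asymptotically invariant in norm
(`IsTwoSidedMean.exists_isApproximateMean`). Its weak* cluster points in the bidual are means, hence
all equal to `m`, so by Banach–Alaoglu the whole sequence converges weak* to `m`. It is therefore
weakly Cauchy, and weak sequential completeness puts its limit in `A`. -/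

namespace BanachMean

open Filter Topology

/-! ### Approximation of bidual elements by bounded sequences -/

section Approximation

variable {E G : Type*} [NormedAddCommGroup E] [NormedSpace ℂ E]
  [NormedAddCommGroup G] [NormedSpace ℂ G]

/-- If the second adjoint of `T` maps `m` into the canonical image of `y`, then `y` is a norm limit
of values of `T` on the ball of radius `‖m‖`. -/
theorem exists_norm_le_norm_sub_lt (T : E →L[ℂ] G) (y : G)
    (m : StrongDual ℂ (StrongDual ℂ E)) (h : ∀ g : StrongDual ℂ G, m (g.comp T) = g y)
    {ε : ℝ} (hε : 0 < ε) : ∃ u : E, ‖u‖ ≤ ‖m‖ ∧ ‖T u - y‖ < ε := by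
  let S : Set G := T '' Metric.closedBall 0 ‖m‖
  by_cases hy : y ∈ closure S
  · obtain ⟨_, ⟨u, hu, rfl⟩, hd⟩ := Metric.mem_closure_iff.1 hy ε hε
    refine ⟨u, by simpa using hu, ?_⟩
    rwa [dist_comm, dist_eq_norm] at hd
  exfalso
  have hconv : Convex ℝ (closure S) :=
    ((convex_closedBall (0 : E) ‖m‖).linear_image (T.restrictScalars ℝ).toLinearMap).closure
  obtain ⟨g, s, hs, hys⟩ :=
    RCLike.geometric_hahn_banach_closed_point (𝕜 := ℂ) hconv isClosed_closure hy
  -- Separation bounds only the real part of `g`; the ball is balanced, so rotating `u` by a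
  -- unimodular scalar bounds the modulus.
  have hS : ∀ u : E, ‖u‖ ≤ ‖m‖ → ‖g (T u)‖ ≤ s := by
    intro u hu
    obtain ⟨c, hc, hcu⟩ := RCLike.exists_norm_eq_mul_self (K := ℂ) (g (T u))
    have h1 := hs (T (c • u)) (subset_closure ⟨c • u, by simpa [norm_smul, hc] using hu, rfl⟩)
    rw [map_smul, map_smul, smul_eq_mul, ← hcu] at h1
    simpa using h1.le
  have hs0 : 0 ≤ s := (norm_nonneg _).trans (hS 0 (norm_zero.trans_le (norm_nonneg m)))
  have hle : ‖m (g.comp T)‖ ≤ s := by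
    rcases (norm_nonneg m).eq_or_lt with hm | hm
    · refine (m.le_opNorm _).trans ?_
      rwa [← hm, zero_mul]
    have hg : ‖g.comp T‖ ≤ s / ‖m‖ := by
      refine ContinuousLinearMap.opNorm_le_of_unit_norm (𝕜 := ℂ) (by positivity) fun x hx => ?_
      have := hS ((‖m‖ : ℂ) • x) (by simp [norm_smul, hx, abs_of_pos hm])
      rw [map_smul, map_smul, norm_smul] at this
      rw [le_div_iff₀ hm, mul_comm]
      simpa [abs_of_pos hm] using this
    calc ‖m (g.comp T)‖ ≤ ‖m‖ * ‖g.comp T‖ := m.le_opNorm _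
      _ ≤ ‖m‖ * (s / ‖m‖) := by gcongr
      _ = s := by field_simp
  rw [h g] at hle
  -- The contradiction is `s < re (g y) ≤ ‖g y‖ = ‖m (g ∘ T)‖ ≤ s`.
  exact absurd (hys.trans_le ((RCLike.re_le_norm _).trans hle)) (lt_irrefl _)

/-- A countable family of conditions on an element of the bidual is realized in the limit by a
bounded sequence. -/
theorem exists_seq_tendsto {ι : Type*} [Countable ι] [Nonempty ι] (T : ι → E →L[ℂ] G) (y : ι → G)
    (m : StrongDual ℂ (StrongDual ℂ E))
    (h : ∀ i, ∀ g : StrongDual ℂ G, m (g.comp (T i)) = g (y i)) :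
    ∃ u : ℕ → E, (∀ n, ‖u n‖ ≤ ‖m‖) ∧
      ∀ i, Tendsto (fun n => T i (u n)) atTop (𝓝 (y i)) := by
  obtain ⟨e, he⟩ := exists_surjective_nat ι
  have key : ∀ n : ℕ, ∃ u : E, ‖u‖ ≤ ‖m‖ ∧
      ∀ k : Fin n, ‖T (e k) u - y (e k)‖ < 1 / ((n : ℝ) + 1) := by
    intro n
    -- One vector must meet the first `n` conditions at once, so the operators are bundled into a
    -- single map to `Fin n → G`, whose functionals are sums of functionals of the coordinates.
    obtain ⟨u, hu, hT⟩ := exists_norm_le_norm_sub_lt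
      (ContinuousLinearMap.pi fun k : Fin n => T (e k)) (fun k => y (e k)) m (fun g => by
        have hg : ∀ v : Fin n → G,
            g v = ∑ k, g.comp (ContinuousLinearMap.single ℂ (fun _ : Fin n => G) k) (v k) := by
          intro v
          conv_lhs => rw [← Finset.univ_sum_single v]
          rw [map_sum]
          rfl
        have hc : g.comp (ContinuousLinearMap.pi fun k : Fin n => T (e k)) =
            ∑ k, (g.comp (ContinuousLinearMap.single ℂ (fun _ : Fin n => G) k)).comp (T (e k)) := by
          ext x
          rw [ContinuousLinearMap.comp_apply, hg, sum_apply]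
          rfl
        rw [hc, map_sum, hg]
        exact Finset.sum_congr rfl fun k _ => h _ _) (Nat.one_div_pos_of_nat (α := ℝ) (n := n))
    exact ⟨u, hu, fun k => (norm_le_pi_norm _ k).trans_lt hT⟩
  choose u hu hk using key
  refine ⟨u, hu, fun i => ?_⟩
  obtain ⟨j, rfl⟩ := he i
  rw [tendsto_iff_norm_sub_tendsto_zero]
  refine squeeze_zero' (Eventually.of_forall fun n => norm_nonneg _) ?_
    (tendsto_one_div_add_atTop_nhds_zero_nat (𝕜 := ℝ))
  filter_upwards [eventually_gt_atTop j] with n hn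
  exact (hk n ⟨j, hn⟩).le

end Approximation

variable {A : Type*} [NonUnitalNormedRing A] [NormedSpace ℂ A]
  [IsScalarTower ℂ A A] [SMulCommClass ℂ A A]

/-! ### Functionals on the multiplier completion -/

theorem multiplierNorm_le_norm (a : A) : multiplierNorm a ≤ ‖a‖ :=
  multiplierNorm_le a (norm_nonneg a) (fun b => norm_mul_le a b)
    fun b => (norm_mul_le b a).trans_eq (mul_comm _ _)

/-- The canonical map `A → A_M` as a continuous linear map. -/
noncomputable def inclL : A →L[ℂ] MultiplierCompletion A :=
  MultiplierCompletion.incl.mkContinuous 1 fun a => by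
    rw [MultiplierCompletion.norm_incl, one_mul]
    exact multiplierNorm_le_norm a

@[simp] theorem inclL_apply (a : A) : inclL a = MultiplierCompletion.incl a := rfl

/-- A functional bounded for the multiplier norm extends to `A_M`. -/
theorem exists_extension (f : StrongDual ℂ A) (C : ℝ) (hf : ∀ a, ‖f a‖ ≤ C * multiplierNorm a) :
    ∃ F : StrongDual ℂ (MultiplierCompletion A), F.comp inclL = f := by
  let f' : WithMultiplierNorm A →ₗ[ℂ] ℂ := (f.toLinearMap : A →ₗ[ℂ] ℂ)
  let g : WithMultiplierNorm A →L[ℂ] ℂ := f'.mkContinuous C hf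
  let i : WithMultiplierNorm A →L[ℂ] UniformSpace.Completion (WithMultiplierNorm A) :=
    UniformSpace.Completion.toComplL
  have hi : DenseRange i := UniformSpace.Completion.denseRange_coe
  have hu : IsUniformInducing i := UniformSpace.Completion.isUniformInducing_coe _
  refine ⟨(g.extend i : UniformSpace.Completion (WithMultiplierNorm A) →L[ℂ] ℂ), ?_⟩
  ext a
  exact g.extend_eq hi hu a

/-- The factor `a` makes the functional see `b` only through `a * b`, whose norm is at most `‖a‖`
times the multiplier norm of `b`. -/
theorem exists_extension_dualMul (f : StrongDual ℂ A) (a : A) :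
    ∃ F : StrongDual ℂ (MultiplierCompletion A), F.comp inclL = dualMul A f a := by
  refine exists_extension _ (‖f‖ * ‖a‖) fun b => ?_
  rw [dualMul_apply, mul_assoc]
  refine (f.le_opNorm _).trans (mul_le_mul_of_nonneg_left ?_ (norm_nonneg f))
  rw [mul_comm]
  exact norm_mul_le_multiplierNorm' b a

@[simp] theorem charDual_apply (φ : WeakDual.characterSpace ℂ A) (a : A) :
    charDual φ a = φ a := rfl

theorem exists_char_eq_one (φ : WeakDual.characterSpace ℂ A) : ∃ a : A, φ a = 1 := by
  obtain ⟨a, ha⟩ : ∃ a : A, φ a ≠ 0 := by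
    by_contra! h
    exact φ.2.1 (DFunLike.ext _ _ h)
  exact ⟨(φ a)⁻¹ • a, by rw [map_smul, smul_eq_mul, inv_mul_cancel₀ ha]⟩

theorem dualMul_charDual (φ : WeakDual.characterSpace ℂ A) (a : A) :
    dualMul A (charDual φ) a = φ a • charDual φ := by
  ext b
  simp [map_mul]

/-- The functional on `A_M*` induced by an element of the bidual of `A`. -/
noncomputable def bidualMap (m : StrongDual ℂ (StrongDual ℂ A)) :
    StrongDual ℂ (StrongDual ℂ (MultiplierCompletion A)) :=
  m.comp ((ContinuousLinearMap.compL ℂ A (MultiplierCompletion A) ℂ).flip inclL)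

@[simp] theorem bidualMap_apply (m : StrongDual ℂ (StrongDual ℂ A))
    (F : StrongDual ℂ (MultiplierCompletion A)) : bidualMap m F = m (F.comp inclL) := rfl

theorem strongDual_ext_incl {F G : StrongDual ℂ (MultiplierCompletion A)}
    (h : ∀ a : A, F (MultiplierCompletion.incl a) = G (MultiplierCompletion.incl a)) : F = G := by
  ext x
  exact MultiplierCompletion.induction₁ (p := fun x => F x = G x)
    (isClosed_eq F.continuous G.continuous) h x

/-! ### Uniqueness of the mean from Arens regularity -/

section Uniqueness

variable {φ : WeakDual.characterSpace ℂ A} {m n : StrongDual ℂ (StrongDual ℂ A)}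
  {Φ : StrongDual ℂ (MultiplierCompletion A)}

/-- By density it suffices to compare both sides on the image of `A`, where left invariance of `n`
applies to the restriction of `F`. -/
theorem bidualMul_bidualMap (hn : IsTwoSidedMean φ n) (hΦ : Φ.comp inclL = charDual φ)
    (F : StrongDual ℂ (MultiplierCompletion A)) :
    bidualMul (bidualMap n) F = bidualMap n F • Φ := by
  refine strongDual_ext_incl fun a => ?_
  have h1 : (dualMul _ F (MultiplierCompletion.incl a)).comp inclL =
      dualMul A (F.comp inclL) a := by
    ext b
    simp [MultiplierCompletion.incl_mul]
  have h2 : Φ (MultiplierCompletion.incl a) = φ a := DFunLike.congr_fun hΦ a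
  rw [bidualMul_apply, bidualMap_apply, h1, hn.left_inv, smul_apply, h2,
    bidualMap_apply, smul_eq_mul, mul_comm]

theorem mulBidual_bidualMap (hm : IsTwoSidedMean φ m) (hΦ : Φ.comp inclL = charDual φ)
    (F : StrongDual ℂ (MultiplierCompletion A)) :
    mulBidual (bidualMap m) F = bidualMap m F • Φ := by
  refine strongDual_ext_incl fun a => ?_
  have h1 : (mulDual _ F (MultiplierCompletion.incl a)).comp inclL =
      mulDual A (F.comp inclL) a := by
    ext b
    simp [MultiplierCompletion.incl_mul]
  have h2 : Φ (MultiplierCompletion.incl a) = φ a := DFunLike.congr_fun hΦ a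
  rw [mulBidual_apply, bidualMap_apply, h1, hm.right_inv, smul_apply, h2,
    bidualMap_apply, smul_eq_mul, mul_comm]

/-- If `A_M` is Arens regular, there is at most one two-sided invariant mean. -/
theorem IsTwoSidedMean.unique (hreg : IsArensRegular (MultiplierCompletion A))
    (hm : IsTwoSidedMean φ m) (hn : IsTwoSidedMean φ n) : m = n := by
  obtain ⟨a, ha⟩ := exists_char_eq_one φ
  obtain ⟨Φ, hΦ⟩ := exists_extension_dualMul (charDual φ) a
  rw [dualMul_charDual, ha, one_smul] at hΦ
  ext f
  obtain ⟨F, hF⟩ := exists_extension_dualMul f a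
  have h := DFunLike.congr_fun (hreg (bidualMap m) (bidualMap n)) F
  simp only [leftArens, rightArens, ContinuousLinearMap.comp_apply, bidualMul_bidualMap hn hΦ,
    mulBidual_bidualMap hm hΦ, map_smul] at h
  simp only [bidualMap_apply, hΦ, hF, hm.map_char, hn.map_char, hm.left_inv, hn.left_inv, ha,
    smul_eq_mul, mul_one, one_mul] at h
  exact h.symm

end Uniqueness

/-! ### Approximate means -/

/-- A bounded sequence in `A` that is asymptotically two-sided invariant and normalized. -/
structure IsApproximateMean (φ : WeakDual.characterSpace ℂ A) (u : ℕ → A) (C : ℝ) : Prop where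
  norm_le : ∀ n, ‖u n‖ ≤ C
  tendsto_char : Tendsto (fun n => φ (u n)) atTop (𝓝 1)
  tendsto_left : ∀ a, Tendsto (fun n => a * u n - φ a • u n) atTop (𝓝 0)
  tendsto_right : ∀ a, Tendsto (fun n => u n * a - φ a • u n) atTop (𝓝 0)

/-- Convergence to zero of a bounded sequence of operators on a dense set propagates. -/
theorem tendsto_zero_of_dense {S : ℕ → A →L[ℂ] A} {C : ℝ} (hS : ∀ n, ‖S n‖ ≤ C) {D : Set A}
    (hD : Dense D) (h : ∀ d ∈ D, Tendsto (fun n => S n d) atTop (𝓝 0)) (a : A) :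
    Tendsto (fun n => S n a) atTop (𝓝 0) := by
  have hC : 0 ≤ C := (norm_nonneg _).trans (hS 0)
  rw [Metric.tendsto_atTop]
  intro ε hε
  -- `C + 1` replaces `C` because `C` may be zero.
  obtain ⟨d, hd, had⟩ := Metric.dense_iff.1 hD a (ε / (2 * (C + 1))) (by positivity)
  obtain ⟨N, hN⟩ := Metric.tendsto_atTop.1 (h _ had) (ε / 2) (by positivity)
  refine ⟨N, fun n hn => ?_⟩
  have h1 := hN n hn
  rw [dist_zero_right] at h1 ⊢
  rw [Metric.mem_ball, dist_comm, dist_eq_norm] at hd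
  have h2 : ‖S n (a - d)‖ ≤ ε / 2 := by
    calc ‖S n (a - d)‖ ≤ C * ‖a - d‖ := (S n).le_of_opNorm_le (hS n) _
      _ ≤ (C + 1) * (ε / (2 * (C + 1))) := by gcongr; linarith
      _ = ε / 2 := by field_simp
  calc ‖S n a‖ = ‖S n (a - d) + S n d‖ := by rw [map_sub, sub_add_cancel]
    _ ≤ ‖S n (a - d)‖ + ‖S n d‖ := norm_add_le _ _
    _ < ε := by linarith

variable {φ : WeakDual.characterSpace ℂ A}

/-- Invariance says that the second adjoints of `b ↦ a b - φ(a) b` and `b ↦ b a - φ(a) b` kill `m`.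
Countably many such conditions, for `a` in a dense sequence, are realized in norm by a bounded
sequence; boundedness then carries them to every `a`. -/
theorem IsTwoSidedMean.exists_isApproximateMean [TopologicalSpace.SeparableSpace A]
    {m : StrongDual ℂ (StrongDual ℂ A)} (hm : IsTwoSidedMean φ m) :
    ∃ u : ℕ → A, IsApproximateMean φ u ‖m‖ := by
  obtain ⟨a₀, ha₀⟩ := exists_char_eq_one φ
  let d := TopologicalSpace.denseSeq A
  have hd : Dense (Set.range d) := TopologicalSpace.denseRange_denseSeq A
  let L : A → A →L[ℂ] A := fun a => ContinuousLinearMap.mul ℂ A a - φ a • ContinuousLinearMap.id ℂ A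
  let R : A → A →L[ℂ] A := fun a =>
    (ContinuousLinearMap.mul ℂ A).flip a - φ a • ContinuousLinearMap.id ℂ A
  -- All conditions need the same codomain, so the normalization `φ(u) → 1` is coded by the rank-one
  -- operator `b ↦ φ(b) a₀` with target `a₀`.
  let T : Option (ℕ ⊕ ℕ) → A →L[ℂ] A := fun i =>
    i.elim ((charDual φ).smulRight a₀) (Sum.elim (fun k => L (d k)) fun k => R (d k))
  let y : Option (ℕ ⊕ ℕ) → A := fun i => i.elim a₀ fun _ => 0
  obtain ⟨u, hu, hT⟩ := exists_seq_tendsto T y m (by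
    rintro (_ | k | k) f
    · have : f.comp ((charDual φ).smulRight a₀) = f a₀ • charDual φ := by
        ext b
        simp [mul_comm]
      change m (f.comp ((charDual φ).smulRight a₀)) = f a₀
      rw [this, map_smul, hm.map_char, smul_eq_mul, mul_one]
    · have : f.comp (L (d k)) = dualMul A f (d k) - φ (d k) • f := by
        ext b
        simp [L]
      change m (f.comp (L (d k))) = f 0
      rw [this, map_sub, hm.left_inv, map_smul, smul_eq_mul, sub_self, map_zero]
    · have : f.comp (R (d k)) = mulDual A f (d k) - φ (d k) • f := by
        ext b
        simp [R]
      change m (f.comp (R (d k))) = f 0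
      rw [this, map_sub, hm.right_inv, map_smul, smul_eq_mul, sub_self, map_zero])
  have hbound : ∀ (n : ℕ) (a : A), ‖φ a • u n‖ ≤ ‖charDual φ‖ * ‖m‖ * ‖a‖ := by
    intro n a
    rw [norm_smul]
    calc ‖φ a‖ * ‖u n‖ ≤ (‖charDual φ‖ * ‖a‖) * ‖m‖ :=
          mul_le_mul ((charDual φ).le_opNorm a) (hu n) (norm_nonneg _) (by positivity)
      _ = _ := by ring
  refine ⟨u, hu, ?_, ?_, ?_⟩
  · have h := ((charDual φ).continuous.tendsto a₀).comp (hT none)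
    simpa [T, Function.comp_def, ha₀] using h
  -- The roles are exchanged: `a` is now the variable and `u n` indexes the uniformly bounded
  -- operators `a ↦ a u_n - φ(a) u_n`.
  · refine tendsto_zero_of_dense (C := ‖m‖ + ‖charDual φ‖ * ‖m‖)
      (S := fun n => (ContinuousLinearMap.mul ℂ A).flip (u n) - (charDual φ).smulRight (u n))
      (fun n => ContinuousLinearMap.opNorm_le_bound _ (by positivity) fun a => ?_) hd ?_
    · rw [add_mul]
      refine (norm_sub_le _ _).trans (add_le_add ?_ (hbound n a))
      calc ‖a * u n‖ ≤ ‖a‖ * ‖u n‖ := norm_mul_le _ _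
        _ ≤ ‖a‖ * ‖m‖ := by gcongr; exact hu n
        _ = _ := mul_comm _ _
    · rintro _ ⟨k, rfl⟩
      exact hT (some (Sum.inl k))
  · refine tendsto_zero_of_dense (C := ‖m‖ + ‖charDual φ‖ * ‖m‖)
      (S := fun n => ContinuousLinearMap.mul ℂ A (u n) - (charDual φ).smulRight (u n))
      (fun n => ContinuousLinearMap.opNorm_le_bound _ (by positivity) fun a => ?_) hd ?_
    · rw [add_mul]
      refine (norm_sub_le _ _).trans (add_le_add ?_ (hbound n a))
      calc ‖u n * a‖ ≤ ‖u n‖ * ‖a‖ := norm_mul_le _ _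
        _ ≤ ‖m‖ * ‖a‖ := by gcongr; exact hu n
    · rintro _ ⟨k, rfl⟩
      exact hT (some (Sum.inr k))

/-- Limits along ultrafilters of an approximate mean are invariant means. -/
theorem IsApproximateMean.isTwoSidedMean_of_tendsto {u : ℕ → A} {C : ℝ}
    (hu : IsApproximateMean φ u C) {U : Filter ℕ} [U.NeBot] (hU : U ≤ atTop)
    {m : StrongDual ℂ (StrongDual ℂ A)}
    (h : ∀ f : StrongDual ℂ A, Tendsto (fun n => f (u n)) U (𝓝 (m f))) :
    IsTwoSidedMean φ m where
  map_char := tendsto_nhds_unique (h (charDual φ)) (hu.tendsto_char.mono_left hU)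
  left_inv f a := by
    have h1 := (f.continuous.tendsto 0).comp ((hu.tendsto_left a).mono_left hU)
    have h2 := (h (dualMul A f a)).sub ((h f).const_mul (φ a))
    refine sub_eq_zero.1 (tendsto_nhds_unique h2 ?_)
    simpa [Function.comp_def] using h1
  right_inv f a := by
    have h1 := (f.continuous.tendsto 0).comp ((hu.tendsto_right a).mono_left hU)
    have h2 := (h (mulDual A f a)).sub ((h f).const_mul (φ a))
    refine sub_eq_zero.1 (tendsto_nhds_unique h2 ?_)
    simpa [Function.comp_def] using h1

/-- If there is at most one invariant mean, an approximate mean converges to it. -/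
theorem IsApproximateMean.tendsto_of_unique {u : ℕ → A} {C : ℝ} (hu : IsApproximateMean φ u C)
    {m : StrongDual ℂ (StrongDual ℂ A)}
    (huniq : ∀ n : StrongDual ℂ (StrongDual ℂ A), IsTwoSidedMean φ n → n = m)
    (f : StrongDual ℂ A) : Tendsto (fun n => f (u n)) atTop (𝓝 (m f)) := by
  let v : ℕ → WeakDual ℂ (StrongDual ℂ A) := fun n =>
    StrongDual.toWeakDual (NormedSpace.inclusionInDoubleDual ℂ A (u n))
  have hv : Tendsto v atTop (𝓝 (StrongDual.toWeakDual m)) := by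
    -- In a weak* compact ball, a sequence with only one possible cluster point converges; each
    -- cluster point is a limit along an ultrafilter, hence a mean.
    refine (WeakDual.isCompact_closedBall (𝕜 := ℂ) (E := StrongDual ℂ A) 0
      C).tendsto_nhds_of_unique_mapClusterPt (Eventually.of_forall fun n => ?_) fun p _ hp => ?_
    · simpa [v] using
        (NormedSpace.double_dual_bound ℂ A (u n)).trans (hu.norm_le n)
    · obtain ⟨U, hU, hUp⟩ := mapClusterPt_iff_ultrafilter.1 hp
      have := huniq (WeakDual.toStrongDual p) (hu.isTwoSidedMean_of_tendsto hU fun g =>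
        ((WeakDual.eval_continuous g).tendsto p).comp hUp)
      rw [← this]
      rfl
  exact ((WeakDual.eval_continuous f).tendsto _).comp hv

theorem IsTwoSidedMean.exists_inclusion_eq [TopologicalSpace.SeparableSpace A]
    (hwsc : IsWeaklySequentiallyComplete A) {m : StrongDual ℂ (StrongDual ℂ A)}
    (hm : IsTwoSidedMean φ m)
    (huniq : ∀ n : StrongDual ℂ (StrongDual ℂ A), IsTwoSidedMean φ n → n = m) :
    ∃ u : A, NormedSpace.inclusionInDoubleDual ℂ A u = m := by
  obtain ⟨x, hx⟩ := hm.exists_isApproximateMean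
  obtain ⟨u, hu⟩ := hwsc x fun f => (hx.tendsto_of_unique huniq f).cauchySeq
  exact ⟨u, ContinuousLinearMap.ext fun f =>
    tendsto_nhds_unique (hu f) (hx.tendsto_of_unique huniq f)⟩

end BanachMean

theorem mainTheorem12 {A : Type*} [NonUnitalNormedRing A] [NormedSpace ℂ A]
    [IsScalarTower ℂ A A] [SMulCommClass ℂ A A] [CompleteSpace A]
    [TopologicalSpace.SeparableSpace A]
    (hwsc : BanachMean.IsWeaklySequentiallyComplete A)
    (hfaith : BanachMean.IsFaithful A)
    (φ : WeakDual.characterSpace ℂ A)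
    (hspan : BanachMean.closedSpanMulAugIdeal φ = BanachMean.augIdeal φ)
    (hamen : BanachMean.IsTwoSidedAmenable φ)
    (hreg : BanachMean.IsArensRegular (BanachMean.MultiplierCompletion A)) :
    (∃! m : StrongDual ℂ (StrongDual ℂ A), BanachMean.IsTwoSidedMean φ m) ∧
      ∃! u : A, BanachMean.IsTwoSidedMean φ (NormedSpace.inclusionInDoubleDual ℂ A u) := by
  obtain ⟨m, hm⟩ := hamen
  have huniq : ∀ n, BanachMean.IsTwoSidedMean φ n → n = m := fun n hn => hn.unique hreg hm
  obtain ⟨u, rfl⟩ := hm.exists_inclusion_eq hwsc huniq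
  exact ⟨⟨_, hm, huniq⟩, u, hm, fun v hv =>
    (NormedSpace.inclusionInDoubleDualLi ℂ (E := A)).injective (huniq _ hv)⟩
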